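/- Let $X$ be a (nonempty) compact geodesic metric space, i.e. any two points $x,y\in X$ are joined by a curve isometric to the interval $[0,d(x,y)]$. Definitions. A closed geodesic of length $L>0$ is a map from the circle of circumference $L$ (with its arc metric) to $X$ whose restriction to every sufficiently small arc is an isometry onto its image. The $1$-systole $\sigma_1\in[0,\infty]$ of $X$ is the infimum of the lengths of the closed geodesics in $X$ that are not null-homotopic ($\sigma_1=\infty$ if there are none). For $\varepsilon>0$, an $\varepsilon$-chain is a finite sequence $\{x_0,\dots,x_n\}$ in $X$ with $d(x_i,x_{i+1})<\varepsilon$ for all $i$; it is an $\varepsilon$-loop if $x_n=x_0$. Two $\varepsilon$-chains with the same endpoints are $\varepsilon$-homotopic if one can be transformed into the other by finitely many steps, each of which adds or removes a single point, such that all intermediate sequences are $\varepsilon$-chains with the same endpoints. An $\varepsilon$-loop $\{x_0,\dots,x_n=x_0\}$ is $\varepsilon$-null if it is $\varepsilon$-homotopic to $\{x_0\}$, and $\varepsilon$-critical if it is not $\varepsilon$-null but is $\delta$-null for all $\delta>\varepsilon$. The number $\varepsilon>0$ is a homotopy critical value of $X$ if an $\varepsilon$-critical $\varepsilon$-loop exists;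 the homotopy critical spectrum is the set of all homotopy critical values. The space $X$ is semilocally simply connected if every point has an open neighbourhood $U$ such that every loop in $U$ is null-homotopic in $X$. Corollary. (1) $\sigma_1/3$ is a lower bound for the homotopy critical spectrum of $X$, that is, $\sigma_1/3\le\varepsilon$ for every homotopy critical value $\varepsilon$ (in particular there are none if $\sigma_1=\infty$). (2) If $X$ is semilocally simply connected and not simply connected, then $0<\sigma_1<\infty$ and $\sigma_1/3$ is the smallest homotopy critical value of $X$ (in particular it is a homotopy critical value). -/

import Mathlib

open Set Topology
open scoped ENNReal

noncomputable section

namespace DiscreteHomotopy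

/-- A metric space is geodesic if any two points are joined by an arclength parameterized
curve whose length is the distance of its endpoints, i.e. by an isometric embedding of the interval
`[0, dist x y]`. -/
def IsGeodesicSpace (X : Type*) [MetricSpace X] : Prop :=
  ∀ x y : X, ∃ γ : ℝ → X, γ 0 = x ∧ γ (dist x y) = y ∧
    ∀ s ∈ Icc (0 : ℝ) (dist x y), ∀ t ∈ Icc (0 : ℝ) (dist x y), dist (γ s) (γ t) = |s - t|

/-- Every point has an open neighbourhood `U` such that every loop in `U` is null-homotopic
in the whole space. -/
def SemilocallySimplyConnected (X : Type*) [TopologicalSpace X] : Prop :=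
  ∀ x : X, ∃ U : Set X, IsOpen U ∧ x ∈ U ∧
    ∀ (y : X) (γ : Path y y), range γ ⊆ U → γ.Homotopic (Path.refl y)

section Chains

variable {X : Type*} [MetricSpace X]

/-- An `ε`-chain: a finite (nonempty) sequence of points whose consecutive members have
distance `< ε`. -/
def IsEpsChain (ε : ℝ) (α : List X) : Prop :=
  α ≠ [] ∧ α.IsChain (fun x y => dist x y < ε)

/-- `β` arises from `α` by inserting a single point somewhere. -/
def InsertsPoint (α β : List X) : Prop :=
  ∃ (l₁ l₂ : List X) (x : X), α = l₁ ++ l₂ ∧ β = l₁ ++ x :: l₂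

/-- A basic move between two `ε`-chains with the same endpoints: adding or removing a single
point. -/
def BasicMove (ε : ℝ) (α β : List X) : Prop :=
  IsEpsChain ε α ∧ IsEpsChain ε β ∧ α.head? = β.head? ∧ α.getLast? = β.getLast? ∧
    (InsertsPoint α β ∨ InsertsPoint β α)

/-- `ε`-homotopy: a finite sequence of basic moves through `ε`-chains, all of them with the same
endpoints. -/
def EpsHomotopic (ε : ℝ) (α β : List X) : Prop :=
  IsEpsChain ε α ∧ IsEpsChain ε β ∧ Relation.ReflTransGen (BasicMove ε) α β

/-- An `ε`-loop based at `x`: an `ε`-chain that starts and ends at `x`. -/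
def IsEpsLoop (ε : ℝ) (x : X) (α : List X) : Prop :=
  IsEpsChain ε α ∧ α.head? = some x ∧ α.getLast? = some x

/-- A loop based at `x` is `ε`-null if it is `ε`-homotopic to the trivial loop `{x}`. -/
def IsEpsNull (ε : ℝ) (x : X) (α : List X) : Prop :=
  EpsHomotopic ε α [x]

/-- An `ε`-loop is `ε`-critical if it is not `ε`-null, but is `δ`-null for all `δ > ε`. -/
def IsEpsCritical (ε : ℝ) (x : X) (α : List X) : Prop :=
  IsEpsLoop ε x α ∧ ¬ IsEpsNull ε x α ∧ ∀ δ : ℝ, ε < δ → IsEpsNull δ x α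

variable (X) in
/-- The set of homotopy critical values: all `ε > 0` for which an `ε`-critical `ε`-loop exists. -/
def homotopyCriticalSpectrum : Set ℝ :=
  {ε | 0 < ε ∧ ∃ (x : X) (α : List X), IsEpsCritical ε x α}

end Chains

section Systole

variable {X : Type*} [MetricSpace X]

/-- A closed geodesic of length `L > 0`: a map from the circle of circumference `L` (with its arc
metric, which is the metric of `AddCircle L`) whose restriction to every sufficiently small arc is
distance preserving. -/
def IsClosedGeodesic (L : ℝ) (c : C(AddCircle L, X)) : Prop :=
  0 < L ∧ ∃ r : ℝ, 0 < r ∧ ∀ s t : AddCircle L, dist s t < r → dist (c s) (c t) = dist s t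

variable (X) in
/-- The lengths of the closed geodesics that are not null-homotopic. -/
def nonNullGeodesicLengths : Set ℝ :=
  {L | ∃ c : C(AddCircle L, X), IsClosedGeodesic L c ∧ ¬ c.Nullhomotopic}

variable (X) in
/-- The `1`-systole: the infimum of the lengths of the closed geodesics that are not
null-homotopic, taken in `[0, ∞]` (so it is `∞` if there are none). -/
def oneSystole : ℝ≥0∞ :=
  ⨅ L ∈ nonNullGeodesicLengths X, ENNReal.ofReal L

end Systole

end DiscreteHomotopy

end

/-!
The `ε`-homotopy classes of `ε`-chains with a fixed initial point form a covering of `X`, whose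
monodromy is a function of two points at distance `< ε` with values in a group that is
multiplicative on small triangles: a local cocycle. A local cocycle can be integrated along curves,
and a shortest loop along which its increment is nontrivial is an isometrically embedded circle,
because a shortcut would split it into two shorter loops with trivial increments. If all loops
shorter than `L` have trivial increments, integration along geodesics extends the cocycle to the
scale `L / 3`, where triangles have perimeter `< L`. Since an `ε`-critical loop is nontrivial for
the cocycle of chains but null for every larger scale, it forces a closed geodesic of length at
most `3 * ε` that is not null-homotopic.

In a semilocally simply connected space the classes of geodesics in the fundamental group form a
local cocycle whose increments are trivial exactly along null-homotopic loops. Hence `σ₁` is the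
length `L` of its shortest loop with nontrivial increment, and six equidistant points on that loop
form an `L / 3`-critical loop: the cocycle at the scale `L / 3` detects it, while at any larger
scale it reduces to a triangle and then to a point.
-/

noncomputable section

namespace DiscreteHomotopy

open scoped Uniformity

/-! ### Primitives of functions of two points along maps -/

section Primitive

variable {X G S T : Type*} [Group G] [UniformSpace S] [UniformSpace T]
  {e : X → X → G} {f : T → X} {A : T → G}

/-- A primitive along `f` of a group-valued function `e` of two points: a function on the domain
of `f` whose increments between uniformly close parameters are the values of `e`. -/
def IsPrimitive (e : X → X → G) (f : T → X) (A : T → G) : Prop :=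
  ∀ᶠ p in 𝓤 T, A p.1 * e (f p.1) (f p.2) = A p.2

open Classical in
/-- The increment of `e` along `f` from `a` to `b`, i.e. the multiplicative integral
`(A a)⁻¹ * A b` for a primitive `A` along `f`. It has the junk value `1` if there is no
primitive. -/
def increment (e : X → X → G) (f : T → X) (a b : T) : G :=
  if h : ∃ A, IsPrimitive e f A then (h.choose a)⁻¹ * h.choose b else 1

theorem eq_of_eventually_uniformity_eq {α : Type*} [PreconnectedSpace T] {φ : T → α}
    (h : ∀ᶠ p in 𝓤 T, φ p.1 = φ p.2) (s t : T) : φ s = φ t := by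
  have hφ : IsLocallyConstant φ := by
    rw [IsLocallyConstant.iff_eventually_eq]
    intro t
    filter_upwards [mem_nhds_left t h] with s hs using hs.symm
  exact hφ.apply_eq_of_preconnectedSpace s t

theorem IsPrimitive.comp (hA : IsPrimitive e f A) {φ : S → T} (hφ : UniformContinuous φ) :
    IsPrimitive e (f ∘ φ) (A ∘ φ) :=
  hφ.eventually hA

theorem IsPrimitive.increment_eq [PreconnectedSpace T] (hA : IsPrimitive e f A) (a b : T) :
    increment e f a b = (A a)⁻¹ * A b := by
  have hex : ∃ B, IsPrimitive e f B := ⟨A, hA⟩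
  rw [increment, dif_pos hex]
  obtain ⟨B, hB⟩ : ∃ B, B = hex.choose := ⟨_, rfl⟩
  have hB' : IsPrimitive e f B := hB ▸ hex.choose_spec
  have hBA : B a * (A a)⁻¹ = B b * (A b)⁻¹ := by
    refine eq_of_eventually_uniformity_eq (φ := fun t => B t * (A t)⁻¹) ?_ a b
    filter_upwards [hA, hB'] with p hAp hBp
    rw [← hAp, ← hBp]
    group
  rw [← hB, inv_mul_eq_iff_eq_mul, ← mul_assoc, hBA, inv_mul_cancel_right]

@[simp]
theorem increment_self (a : T) : increment e f a a = 1 := by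
  rw [increment]
  split_ifs <;> simp

theorem inv_increment (a b : T) : (increment e f a b)⁻¹ = increment e f b a := by
  rw [increment, increment]
  split_ifs <;> simp

theorem increment_mul_increment (hex : ∃ A, IsPrimitive e f A) (a b c : T) :
    increment e f a b * increment e f b c = increment e f a c := by
  simp only [increment, dif_pos hex]
  group

theorem increment_comp [PreconnectedSpace S] [PreconnectedSpace T] (hex : ∃ A, IsPrimitive e f A)
    {φ : S → T} (hφ : UniformContinuous φ) (a b : S) :
    increment e (f ∘ φ) a b = increment e f (φ a) (φ b) := by
  obtain ⟨A, hA⟩ := hex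
  rw [(hA.comp hφ).increment_eq, hA.increment_eq, Function.comp_apply, Function.comp_apply]

theorem increment_congr {f g : ℝ → X} (hf : ∃ A, IsPrimitive e f A) (hg : ∃ A, IsPrimitive e g A)
    {a b : ℝ} (hab : a ≤ b) (hfg : EqOn f g (Icc a b)) :
    increment e f a b = increment e g a b := by
  have : PreconnectedSpace (Icc a b) := Subtype.preconnectedSpace isPreconnected_Icc
  let a' : Icc a b := ⟨a, left_mem_Icc.2 hab⟩
  let b' : Icc a b := ⟨b, right_mem_Icc.2 hab⟩
  have hcoe : UniformContinuous ((↑) : Icc a b → ℝ) := uniformContinuous_subtype_val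
  calc increment e f a b = increment e (f ∘ (↑)) a' b' := (increment_comp hf hcoe a' b').symm
    _ = increment e (g ∘ (↑)) a' b' := congrArg (increment e · a' b') (funext fun t => hfg t.2)
    _ = increment e g a b := increment_comp hg hcoe a' b'

end Primitive

/-! ### Local cocycles -/

section Cocycle

variable {X G T : Type*} [PseudoMetricSpace X] [Group G] [UniformSpace T]
  {r : ℝ} {e : X → X → G}

/-- A local cocycle at the scale `r > 0`: a group-valued function of two points that is
multiplicative on triangles with sides `< r`. -/
structure IsLocalCocycle (r : ℝ) (e : X → X → G) : Prop where
  pos : 0 < r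
  mul : ∀ {x y z}, dist x y < r → dist y z < r → dist x z < r → e x y * e y z = e x z

theorem IsLocalCocycle.self (he : IsLocalCocycle r e) (x : X) : e x x = 1 := by
  have hx : dist x x < r := by simpa using he.pos
  exact mul_eq_left.1 (he.mul hx hx hx)

theorem IsLocalCocycle.mul_swap (he : IsLocalCocycle r e) {x y : X} (h : dist x y < r) :
    e x y * e y x = 1 := by
  rw [he.mul h (by rwa [dist_comm]) (by simpa using he.pos), he.self]

theorem IsLocalCocycle.isPrimitive_of_dist_lt (he : IsLocalCocycle r e) {f : T → X}
    (hf : ∀ s t, dist (f s) (f t) < r) (a : T) : IsPrimitive e f fun t => e (f a) (f t) :=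
  .of_forall fun _ => he.mul (hf _ _) (hf _ _) (hf _ _)

theorem eventually_uniformity_dist_lt {f : T → X} (hf : UniformContinuous f) {ε : ℝ} (hε : 0 < ε) :
    ∀ᶠ p in 𝓤 T, dist (f p.1) (f p.2) < ε :=
  hf.eventually (Metric.dist_mem_uniformity hε)

theorem IsPrimitive.mul_of_dist_lt (he : IsLocalCocycle r e) {f f' : T → X} {A : T → G}
    (hA : IsPrimitive e f A) (hf : UniformContinuous f) (hf' : UniformContinuous f')
    (hff' : ∀ t, dist (f t) (f' t) < r / 2) :
    IsPrimitive e f' fun t => A t * e (f t) (f' t) := by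
  filter_upwards [hA, eventually_uniformity_dist_lt hf (half_pos he.pos),
    eventually_uniformity_dist_lt hf' (half_pos he.pos)] with ⟨s, t⟩ hAst hfst hfst'
  simp only at hAst hfst hfst' ⊢
  have hs := hff' s
  have ht := hff' t
  have hr := he.pos
  have hdiag := dist_triangle (f s) (f' s) (f' t)
  rw [← hAst, mul_assoc, mul_assoc, he.mul (y := f' s), he.mul (y := f t)] <;> linarith

theorem increment_eq_one_iff_of_dist_lt [PreconnectedSpace T] (he : IsLocalCocycle r e)
    {f f' : T → X} (hex : ∃ A, IsPrimitive e f A) (hf : UniformContinuous f)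
    (hf' : UniformContinuous f') (hff' : ∀ t, dist (f t) (f' t) < r / 2) {a b : T}
    (hab : f a = f b) (hab' : f' a = f' b) :
    increment e f a b = 1 ↔ increment e f' a b = 1 := by
  obtain ⟨A, hA⟩ := hex
  rw [hA.increment_eq, (hA.mul_of_dist_lt he hf hf' hff').increment_eq, hab, hab',
    inv_mul_eq_one, inv_mul_eq_one, mul_left_inj]

theorem exists_int_primitive (g : ℤ → G) : ∃ a : ℤ → G, ∀ k, a k * g k = a (k + 1) := by
  refine ⟨fun k => Int.inductionOn' (motive := fun _ => G) k 0 1 (fun k _ a => a * g k)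
    fun k _ a => a * (g (k - 1))⁻¹, fun k => ?_⟩
  beta_reduce
  rcases le_or_gt 0 k with hk | hk
  · rw [Int.inductionOn'_add_one hk]
  · obtain ⟨k, rfl⟩ : ∃ j, k = j - 1 := ⟨k + 1, by ring⟩
    rw [Int.inductionOn'_sub_one (show k ≤ 0 by lia), inv_mul_cancel_right, sub_add_cancel]

theorem IsLocalCocycle.exists_isPrimitive_of_dist_lt (he : IsLocalCocycle r e) {f : ℝ → X}
    (hf : ∀ s t, |s - t| ≤ 2 → dist (f s) (f t) < r) : ∃ A, IsPrimitive e f A := by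
  obtain ⟨a, ha⟩ := exists_int_primitive fun k : ℤ => e (f k) (f (k + 1 : ℤ))
  let A : ℝ → G := fun t => a ⌊t⌋ * e (f ⌊t⌋) (f t)
  have hA : ∀ s t, s ≤ t → t ≤ s + 1 → A s * e (f s) (f t) = A t := by
    intro s t hst hts
    have hs := Int.floor_le s
    have hs' := Int.lt_floor_add_one s
    have ht := Int.floor_le t
    have hfloor : ⌊t⌋ = ⌊s⌋ ∨ ⌊t⌋ = ⌊s⌋ + 1 := by
      have h₁ := Int.floor_mono hst
      have h₂ := Int.floor_mono hts
      rw [Int.floor_add_one] at h₂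
      lia
    have hsplit : A s * e (f s) (f t) = a ⌊s⌋ * e (f ⌊s⌋) (f t) := by
      rw [mul_assoc, he.mul] <;> exact hf _ _ (abs_le.2 ⟨by linarith, by linarith⟩)
    rcases hfloor with h | h
    · rw [hsplit, ← h]
    · have hcast : (⌊t⌋ : ℝ) = ⌊s⌋ + 1 := by exact_mod_cast h
      rw [hsplit]
      change _ = a ⌊t⌋ * e (f ⌊t⌋) (f t)
      rw [h, ← ha, ← h, mul_assoc, he.mul] <;>
        exact hf _ _ (abs_le.2 ⟨by linarith, by linarith⟩)
  refine ⟨A, ?_⟩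
  filter_upwards [Metric.dist_mem_uniformity one_pos] with ⟨s, t⟩ hst
  have hst : |s - t| < 1 := hst
  rw [abs_lt] at hst
  rcases le_total s t with h | h
  · exact hA s t h (by linarith)
  · rw [← hA t s h (by linarith), mul_assoc,
      he.mul_swap (hf _ _ (abs_le.2 ⟨by linarith, by linarith⟩)), mul_one]

/-- Rescaling the domain reduces to a map that moves points at distance `≤ 2` by less than `r`. -/
theorem IsLocalCocycle.exists_isPrimitive (he : IsLocalCocycle r e) {f : ℝ → X}
    (hf : UniformContinuous f) : ∃ A, IsPrimitive e f A := by
  obtain ⟨η, hη, hfη⟩ := Metric.uniformContinuous_iff.1 hf r he.pos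
  obtain ⟨A, hA⟩ := he.exists_isPrimitive_of_dist_lt (f := fun t => f (η / 3 * t)) fun s t hst =>
    hfη (by rw [Real.dist_eq, ← mul_sub, abs_mul, abs_of_pos (by positivity)]; nlinarith)
  have hrescale : f = (fun t => f (η / 3 * t)) ∘ fun t => 3 / η * t := by
    ext t
    simp only [Function.comp_apply]
    congr 1
    field_simp
  rw [hrescale]
  exact ⟨_, hA.comp Real.uniformContinuous_const_mul⟩

theorem IsLocalCocycle.exists_isPrimitive_Icc (he : IsLocalCocycle r e) {a b : ℝ} (hab : a ≤ b)
    {f : Icc a b → X} (hf : UniformContinuous f) : ∃ A, IsPrimitive e f A := by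
  obtain ⟨A, hA⟩ := he.exists_isPrimitive (f := IccExtend hab f)
    (hf.comp (LipschitzWith.projIcc hab).uniformContinuous)
  have hext : IccExtend hab f ∘ (↑) = f := funext fun t => IccExtend_val hab f t
  exact ⟨A ∘ (↑), hext ▸ hA.comp uniformContinuous_subtype_val⟩

theorem IsLocalCocycle.increment_eq (he : IsLocalCocycle r e) {f : ℝ → X}
    (hf : UniformContinuous f) {a b : ℝ} (hab : a ≤ b)
    (hfr : ∀ s ∈ Icc a b, ∀ t ∈ Icc a b, dist (f s) (f t) < r) :
    increment e f a b = e (f a) (f b) := by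
  have : PreconnectedSpace (Icc a b) := Subtype.preconnectedSpace isPreconnected_Icc
  let a' : Icc a b := ⟨a, left_mem_Icc.2 hab⟩
  let b' : Icc a b := ⟨b, right_mem_Icc.2 hab⟩
  have hP := he.isPrimitive_of_dist_lt (f := f ∘ ((↑) : Icc a b → ℝ))
    (fun s t => hfr _ s.2 _ t.2) a'
  calc increment e f a b = increment e (f ∘ (↑)) a' b' :=
        (increment_comp (he.exists_isPrimitive hf) uniformContinuous_subtype_val a' b').symm
    _ = e (f a) (f b) := by simp [hP.increment_eq, a', b', he.self]

theorem increment_eq_one_of_nullhomotopic (he : IsLocalCocycle r e) {K : Type*} [UniformSpace K]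
    [CompactSpace K] {c : C(K, X)} (hc : c.Nullhomotopic) {φ : ℝ → K} (hφ : UniformContinuous φ)
    {a b : ℝ} (hab : φ a = φ b) : increment e (c ∘ φ) a b = 1 := by
  obtain ⟨x, ⟨H⟩⟩ := hc
  have hH : UniformContinuous H.curry :=
    CompactSpace.uniformContinuous_of_continuous H.curry.continuous
  have huc (g : C(K, X)) : UniformContinuous (g ∘ φ) :=
    (CompactSpace.uniformContinuous_of_continuous g.continuous).comp hφ
  have hstep : ∀ᶠ p in 𝓤 unitInterval,
      (increment e (H.curry p.1 ∘ φ) a b = 1) = (increment e (H.curry p.2 ∘ φ) a b = 1) := by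
    filter_upwards [eventually_uniformity_dist_lt hH (half_pos he.pos)] with p hp
    refine propext (increment_eq_one_iff_of_dist_lt he (he.exists_isPrimitive (huc _)) (huc _)
      (huc _) (fun t => (ContinuousMap.dist_apply_le_dist _).trans_lt hp) ?_ ?_) <;>
    simp [hab]
  have h01 := eq_of_eventually_uniformity_eq
    (φ := fun τ => increment e (H.curry τ ∘ φ) a b = 1) hstep 0 1
  have hconst : IsPrimitive e (fun _ : ℝ => x) fun _ => 1 := .of_forall fun _ => by simp [he.self]
  simpa [hconst.increment_eq, Function.comp_def] using h01

end Cocycle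

/-! ### Increments along rectifiable curves -/

section Curves

variable {X G : Type*} [Group G] {r L : ℝ} {e : X → X → G}

section Pseudo

variable [PseudoMetricSpace X]

theorem lipschitzWith_one_iff_dist_le_sub {f : ℝ → X} :
    LipschitzWith 1 f ↔ ∀ s t, s ≤ t → dist (f s) (f t) ≤ t - s := by
  simp only [lipschitzWith_iff_dist_le_mul, NNReal.coe_one, one_mul, Real.dist_eq]
  constructor
  · intro hf s t hst
    rw [← abs_of_nonneg (sub_nonneg.2 hst), abs_sub_comm]
    exact hf s t
  · intro hf s t
    rcases le_total s t with hst | hst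
    · exact (hf s t hst).trans (abs_sub_comm s t ▸ le_abs_self _)
    · exact dist_comm (f s) (f t) ▸ (hf t s hst).trans (le_abs_self _)

theorem lipschitzWith_one_ite {f g : ℝ → X} (hf : LipschitzWith 1 f) (hg : LipschitzWith 1 g)
    {t : ℝ} (hfg : f t = g t) : LipschitzWith 1 fun u => if u ≤ t then f u else g u := by
  rw [lipschitzWith_one_iff_dist_le_sub] at hf hg ⊢
  intro u v huv
  split_ifs with hu hv hv
  · exact hf u v huv
  · calc dist (f u) (g v) ≤ dist (f u) (f t) + dist (g t) (g v) := hfg ▸ dist_triangle _ _ _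
      _ ≤ (t - u) + (v - t) := add_le_add (hf u t hu) (hg t v (not_le.1 hv).le)
      _ = v - u := by ring
  · exact absurd (huv.trans hv) hu
  · exact hg u v huv

/-- The increments of `e` along the curves from `x` to `y` of length at most `ℓ`, parameterized by
1-Lipschitz maps. -/
def curveIncrements (e : X → X → G) (ℓ : ℝ) (x y : X) : Set G :=
  {g | 0 ≤ ℓ ∧ ∃ f : ℝ → X, LipschitzWith 1 f ∧ f 0 = x ∧ f ℓ = y ∧ increment e f 0 ℓ = g}

namespace IsLocalCocycle

variable {a b : ℝ} {x y z : X} {g h : G}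

theorem increment_mem_curveIncrements (he : IsLocalCocycle r e) {f : ℝ → X}
    (hf : LipschitzWith 1 f) (hab : a ≤ b) :
    increment e f a b ∈ curveIncrements e (b - a) (f a) (f b) := by
  have hshift : LipschitzWith 1 fun u : ℝ => a + u :=
    lipschitzWith_one_iff_dist_le_sub.2 fun s t hst => by
      rw [dist_add_left, dist_comm, Real.dist_eq, abs_of_nonneg (sub_nonneg.2 hst)]
  refine ⟨sub_nonneg.2 hab, f ∘ (a + ·), by simpa using hf.comp hshift, by simp, by simp, ?_⟩
  rw [increment_comp (he.exists_isPrimitive hf.uniformContinuous) hshift.uniformContinuous]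
  simp

theorem mul_mem_curveIncrements (he : IsLocalCocycle r e) (hg : g ∈ curveIncrements e a x y)
    (hh : h ∈ curveIncrements e b y z) : g * h ∈ curveIncrements e (a + b) x z := by
  obtain ⟨ha, f, hf, hfx, hfy, rfl⟩ := hg
  obtain ⟨hb, f', hf', hfy', hfz, rfl⟩ := hh
  have hshift : LipschitzWith 1 fun u : ℝ => u - a :=
    lipschitzWith_one_iff_dist_le_sub.2 fun s t hst => by
      rw [dist_sub_right, dist_comm, Real.dist_eq, abs_of_nonneg (sub_nonneg.2 hst)]
  have hf'' : LipschitzWith 1 (f' ∘ fun u => u - a) := by simpa using hf'.comp hshift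
  have hglue : f a = (f' ∘ fun u => u - a) a := by simp [hfy, hfy']
  let F : ℝ → X := fun u => if u ≤ a then f u else (f' ∘ fun u => u - a) u
  have hF : LipschitzWith 1 F := lipschitzWith_one_ite hf hf'' hglue
  have hFf : EqOn F f (Icc 0 a) := fun u hu => if_pos hu.2
  have hFf' : EqOn F (f' ∘ fun u => u - a) (Icc a (a + b)) := by
    intro u hu
    rcases hu.1.eq_or_lt with rfl | hau
    · exact (if_pos le_rfl).trans hglue
    · exact if_neg hau.not_ge
  have hex {f : ℝ → X} (hf : LipschitzWith 1 f) := he.exists_isPrimitive hf.uniformContinuous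
  have hab : a ≤ a + b := le_add_of_nonneg_right hb
  refine ⟨add_nonneg ha hb, F, hF, (hFf (left_mem_Icc.2 ha)).trans hfx, ?_, ?_⟩
  · simpa using (hFf' (right_mem_Icc.2 hab)).trans (by simp [hfz])
  · calc increment e F 0 (a + b) = increment e F 0 a * increment e F a (a + b) :=
          (increment_mul_increment (hex hF) _ _ _).symm
      _ = increment e f 0 a * increment e (f' ∘ fun u => u - a) a (a + b) := by
          rw [increment_congr (hex hF) (hex hf) ha hFf,
            increment_congr (hex hF) (hex hf'') hab hFf']
      _ = increment e f 0 a * increment e f' 0 b := by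
          rw [increment_comp (hex hf') hshift.uniformContinuous, sub_self, add_sub_cancel_left]

theorem inv_mem_curveIncrements (he : IsLocalCocycle r e) (hg : g ∈ curveIncrements e a x y) :
    g⁻¹ ∈ curveIncrements e a y x := by
  obtain ⟨ha, f, hf, rfl, rfl, rfl⟩ := hg
  have hflip : LipschitzWith 1 fun u : ℝ => a - u :=
    lipschitzWith_one_iff_dist_le_sub.2 fun s t hst => by
      rw [dist_sub_left, dist_comm, Real.dist_eq, abs_of_nonneg (sub_nonneg.2 hst)]
  refine ⟨ha, f ∘ (a - ·), by simpa using hf.comp hflip, by simp, by simp, ?_⟩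
  rw [increment_comp (he.exists_isPrimitive hf.uniformContinuous) hflip.uniformContinuous,
    inv_increment]
  simp

end IsLocalCocycle

/-- All `ℓ` such that some loop of length at most `ℓ` has a nontrivial increment. -/
def nontrivialLoopLengths (e : X → X → G) : Set ℝ :=
  {ℓ | ∃ x, ∃ g ∈ curveIncrements e ℓ x x, g ≠ 1}

theorem IsLocalCocycle.eq_of_mem_curveIncrements (he : IsLocalCocycle r e)
    (hL : L ∈ lowerBounds (nontrivialLoopLengths e)) {a b : ℝ} {x y : X} {g h : G}
    (hg : g ∈ curveIncrements e a x y) (hh : h ∈ curveIncrements e b x y) (hab : a + b < L) :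
    g = h := by
  by_contra hgh
  refine hab.not_ge (hL ⟨x, g * h⁻¹, ?_, mul_inv_eq_one.not.2 hgh⟩)
  exact he.mul_mem_curveIncrements hg (he.inv_mem_curveIncrements hh)

theorem pos_of_mem_nontrivialLoopLengths (hL : L ∈ nontrivialLoopLengths e) : 0 < L := by
  obtain ⟨x, _, ⟨hL0, f, -, -, -, rfl⟩, hinc⟩ := hL
  refine hL0.lt_of_ne' ?_
  rintro rfl
  exact hinc (increment_self 0)

end Pseudo

variable [MetricSpace X]

theorem IsLocalCocycle.isClosed_setOf_increment_ne_one (he : IsLocalCocycle r e) :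
    IsClosed {c : C(unitInterval, X) | c 0 = c 1 ∧ increment e c 0 1 ≠ 1} := by
  refine isClosed_of_closure_subset fun c hc => ?_
  have hc01 : c 0 = c 1 :=
    closure_minimal (t := {c : C(unitInterval, X) | c 0 = c 1}) (fun _ h => h.1)
      (isClosed_eq (by fun_prop) (by fun_prop)) hc
  obtain ⟨c', ⟨hc01', hinc'⟩, hdist⟩ := Metric.mem_closure_iff.1 hc (r / 2) (half_pos he.pos)
  have huc (c : C(unitInterval, X)) : UniformContinuous c :=
    CompactSpace.uniformContinuous_of_continuous c.continuous
  refine ⟨hc01, (increment_eq_one_iff_of_dist_lt he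
    (he.exists_isPrimitive_Icc zero_le_one (huc c)) (huc c) (huc c') (fun t => ?_)
    hc01 hc01').not.2 hinc'⟩
  exact (ContinuousMap.dist_apply_le_dist t).trans_lt hdist

theorem isCompact_setOf_lipschitzWith [CompactSpace X] {T : Type*} [PseudoMetricSpace T]
    (K : NNReal) : IsCompact {f : C(T, X) | LipschitzWith K f} := by
  refine ArzelaAscoli.isCompact_of_equicontinuous _ ?_ ?_
  · have himage : ContinuousMap.toFun '' {f : C(T, X) | LipschitzWith K f} =
        {f : T → X | LipschitzWith K f} :=
      subset_antisymm (by rintro _ ⟨f, hf, rfl⟩; exact hf)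
        fun f hf => ⟨⟨f, hf.continuous⟩, hf, rfl⟩
    rw [himage]
    exact (isClosed_setOfPred_lipschitzWith K).isCompact
  · exact (LipschitzWith.uniformEquicontinuous _ K fun f => f.2).equicontinuous

theorem IsLocalCocycle.isClosed_nontrivialLoopLengths [CompactSpace X]
    (he : IsLocalCocycle r e) : IsClosed (nontrivialLoopLengths e) := by
  let K := {f : C(ℝ, X) | LipschitzWith 1 f}
  have : CompactSpace K := isCompact_iff_compactSpace.1 (isCompact_setOf_lipschitzWith 1)
  let Φ : C(ℝ × K, C(unitInterval, X)) :=
    ContinuousMap.curry ⟨fun p => p.1.2.1 (p.1.1 * p.2), by fun_prop⟩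
  have hinc (p : ℝ × K) : increment e (Φ p) 0 1 = increment e p.2.1 0 p.1 := by
    have hmul : UniformContinuous fun t : unitInterval => p.1 * (t : ℝ) :=
      CompactSpace.uniformContinuous_of_continuous (by fun_prop)
    exact (increment_comp (he.exists_isPrimitive p.2.2.uniformContinuous) hmul 0 1).trans (by simp)
  have hfst : nontrivialLoopLengths e = Ici 0 ∩
      Prod.fst '' (Φ ⁻¹' {c | c 0 = c 1 ∧ increment e c 0 1 ≠ 1}) := by
    ext ℓ
    constructor
    · rintro ⟨x, _, ⟨hℓ, f, hf, rfl, hfℓ, rfl⟩, hne⟩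
      refine ⟨hℓ, (ℓ, ⟨⟨f, hf.continuous⟩, hf⟩), ⟨?_, by rwa [hinc]⟩, rfl⟩
      simpa [Φ] using hfℓ.symm
    · rintro ⟨hℓ, ⟨ℓ, f⟩, ⟨hf01, hne⟩, rfl⟩
      rw [hinc] at hne
      have hf0 : f.1 0 = f.1 ℓ := by simpa [Φ] using hf01
      exact ⟨_, _, ⟨hℓ, f.1, f.2, rfl, hf0.symm, rfl⟩, hne⟩
  rw [hfst]
  exact isClosed_Ici.inter
    (isClosedMap_fst_of_compactSpace _ (he.isClosed_setOf_increment_ne_one.preimage Φ.continuous))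

theorem IsLocalCocycle.exists_isLeast_nontrivialLoopLengths [CompactSpace X]
    (he : IsLocalCocycle r e) (hne : (nontrivialLoopLengths e).Nonempty) :
    ∃ L, IsLeast (nontrivialLoopLengths e) L :=
  ⟨_, he.isClosed_nontrivialLoopLengths.isLeast_csInf hne
    ⟨0, fun _ hL => (pos_of_mem_nontrivialLoopLengths hL).le⟩⟩

end Curves

/-! ### The cocycle of increments along geodesics -/

section Geodesic

variable {X G : Type*} [MetricSpace X] [Group G] {r L : ℝ} {e : X → X → G}

namespace IsGeodesicSpace

theorem exists_lipschitzWith (hX : IsGeodesicSpace X) (x y : X) :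
    ∃ γ : ℝ → X, LipschitzWith 1 γ ∧ γ 0 = x ∧ γ (dist x y) = y := by
  obtain ⟨γ, hγ0, hγ1, hγ⟩ := hX x y
  have hiso : Isometry fun t : Icc 0 (dist x y) => γ t :=
    Isometry.of_dist_eq fun s t => hγ _ s.2 _ t.2
  refine ⟨IccExtend (dist_nonneg (x := x) (y := y)) fun t => γ t, ?_, ?_, ?_⟩
  · simpa only [one_mul] using! hiso.lipschitz.comp (LipschitzWith.projIcc dist_nonneg)
  · exact (IccExtend_left _ _).trans hγ0
  · exact (IccExtend_right _ _).trans hγ1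

/-- A geodesic from `x` to `y`, parameterized by arclength on `[0, dist x y]` and extended to a
1-Lipschitz map on the real line. -/
def geodesic (hX : IsGeodesicSpace X) (x y : X) : ℝ → X :=
  (hX.exists_lipschitzWith x y).choose

theorem lipschitzWith_geodesic (hX : IsGeodesicSpace X) (x y : X) :
    LipschitzWith 1 (hX.geodesic x y) :=
  (hX.exists_lipschitzWith x y).choose_spec.1

@[simp]
theorem geodesic_zero (hX : IsGeodesicSpace X) (x y : X) : hX.geodesic x y 0 = x :=
  (hX.exists_lipschitzWith x y).choose_spec.2.1

@[simp]
theorem geodesic_dist (hX : IsGeodesicSpace X) (x y : X) : hX.geodesic x y (dist x y) = y :=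
  (hX.exists_lipschitzWith x y).choose_spec.2.2

/-- The function of two points given by the increments of `e` along geodesics. It extends the
values of a local cocycle `e` to points at arbitrary distance. -/
def geodesicCocycle (hX : IsGeodesicSpace X) (e : X → X → G) (x y : X) : G :=
  increment e (hX.geodesic x y) 0 (dist x y)

theorem geodesicCocycle_mem_curveIncrements (hX : IsGeodesicSpace X) (e : X → X → G) (x y : X) :
    hX.geodesicCocycle e x y ∈ curveIncrements e (dist x y) x y :=
  ⟨dist_nonneg, _, hX.lipschitzWith_geodesic x y, by simp, by simp, rfl⟩

theorem geodesicCocycle_eq (hX : IsGeodesicSpace X) (he : IsLocalCocycle r e) {x y : X}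
    (hxy : dist x y < r) : hX.geodesicCocycle e x y = e x y := by
  have hγ := hX.lipschitzWith_geodesic x y
  rw [geodesicCocycle, he.increment_eq hγ.uniformContinuous dist_nonneg, geodesic_zero,
    geodesic_dist]
  intro s hs t ht
  calc dist (hX.geodesic x y s) (hX.geodesic x y t) ≤ dist s t := by simpa using hγ.dist_le_mul s t
    _ ≤ dist x y := by simpa using Real.dist_le_of_mem_Icc hs ht
    _ < r := hxy

theorem isLocalCocycle_geodesicCocycle (hX : IsGeodesicSpace X) (he : IsLocalCocycle r e) {δ : ℝ}
    (hδ : 0 < δ) (hL : 3 * δ ∈ lowerBounds (nontrivialLoopLengths e)) :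
    IsLocalCocycle δ (hX.geodesicCocycle e) where
  pos := hδ
  mul {x y z} hxy hyz hxz :=
    he.eq_of_mem_curveIncrements hL
      (he.mul_mem_curveIncrements (hX.geodesicCocycle_mem_curveIncrements e x y)
        (hX.geodesicCocycle_mem_curveIncrements e y z))
      (hX.geodesicCocycle_mem_curveIncrements e x z) (by linarith)

theorem geodesicCocycle_eq_increment (hX : IsGeodesicSpace X) (he : IsLocalCocycle r e)
    (hL : L ∈ lowerBounds (nontrivialLoopLengths e)) {f : ℝ → X} (hf : LipschitzWith 1 f)
    {s t : ℝ} (hst : s ≤ t) (hstL : t - s + dist (f s) (f t) < L) :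
    hX.geodesicCocycle e (f s) (f t) = increment e f s t :=
  (he.eq_of_mem_curveIncrements hL (he.increment_mem_curveIncrements hf hst)
    (hX.geodesicCocycle_mem_curveIncrements e _ _) hstL).symm

theorem nontrivialLoopLengths_nonempty (hX : IsGeodesicSpace X) (he : IsLocalCocycle r e)
    {T : Type*} [UniformSpace T] [PreconnectedSpace T] {f : T → X} (hf : UniformContinuous f)
    {a b : T} (hab : f a = f b) (hinc : increment e f a b ≠ 1) :
    (nontrivialLoopLengths e).Nonempty := by
  by_contra! hempty
  have hcocycle {δ : ℝ} (hδ : 0 < δ) : IsLocalCocycle δ (hX.geodesicCocycle e) :=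
    hX.isLocalCocycle_geodesicCocycle he hδ (by simp [hempty])
  have hmul (x y z : X) : hX.geodesicCocycle e x y * hX.geodesicCocycle e y z =
      hX.geodesicCocycle e x z := by
    have hxy : 0 ≤ dist x y := dist_nonneg
    have hyz : 0 ≤ dist y z := dist_nonneg
    have hxz : 0 ≤ dist x z := dist_nonneg
    refine (hcocycle (δ := dist x y + dist y z + dist x z + 1) (by positivity)).mul ?_ ?_ ?_ <;>
      linarith
  have hP : IsPrimitive e f fun t => hX.geodesicCocycle e (f a) (f t) := by
    filter_upwards [eventually_uniformity_dist_lt hf he.pos] with p hp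
    rw [← hX.geodesicCocycle_eq he hp, hmul]
  exact hinc (by rw [hP.increment_eq, hab, inv_mul_cancel])

end IsGeodesicSpace

end Geodesic

/-! ### Shortest loops with nontrivial increment -/

section ShortestLoop

variable {X G : Type*} [Group G] {r L : ℝ} {e : X → X → G} {f : ℝ → X}

theorem norm_coe_addCircle {u : ℝ} (hu : u ∈ Icc 0 L) : ‖(u : AddCircle L)‖ = min u (L - u) := by
  rcases (hu.1.trans hu.2).eq_or_lt with rfl | hL
  · obtain rfl : u = 0 := by simpa using hu
    simp
  rcases le_total u (L / 2) with h | h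
  · rw [(AddCircle.norm_coe_eq_abs_iff L hL.ne').2 (by rwa [abs_of_nonneg hu.1, abs_of_pos hL]),
      abs_of_nonneg hu.1, min_eq_left (by linarith)]
  · have habs : |u - L| = L - u := by rw [abs_sub_comm, abs_of_nonneg (by linarith [hu.2])]
    have hcoe : (u : AddCircle L) = ((u - L : ℝ) : AddCircle L) := by
      rw [AddCircle.coe_sub, AddCircle.coe_period, sub_zero]
    rw [hcoe, (AddCircle.norm_coe_eq_abs_iff L hL.ne').2 (by rw [habs, abs_of_pos hL]; linarith),
      habs, min_eq_right (by linarith)]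

theorem dist_coe_addCircle {s t : ℝ} (hs : 0 ≤ s) (hst : s ≤ t) (ht : t ≤ L) :
    dist (s : AddCircle L) t = min (t - s) (L - (t - s)) := by
  rw [dist_comm, dist_eq_norm, ← AddCircle.coe_sub,
    norm_coe_addCircle ⟨sub_nonneg.2 hst, by linarith⟩]

theorem lipschitzWith_coe_addCircle (L : ℝ) : LipschitzWith 1 ((↑) : ℝ → AddCircle L) :=
  LipschitzWith.of_dist_le_mul fun s t => by
    rw [dist_eq_norm, ← AddCircle.coe_sub, NNReal.coe_one, one_mul, Real.dist_eq]
    exact QuotientAddGroup.norm_mk_le_norm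

theorem exists_isometry_addCircle [MetricSpace X] (hL : 0 < L)
    (hf : ∀ s t, 0 ≤ s → s ≤ t → t ≤ L → dist (f s) (f t) = min (t - s) (L - (t - s))) :
    ∃ c : C(AddCircle L, X), Isometry c ∧ EqOn (c ∘ (↑)) f (Icc 0 L) := by
  have : Fact (0 < L) := ⟨hL⟩
  have hlift : EqOn (AddCircle.liftIco L 0 f ∘ (↑)) f (Ico 0 L) :=
    fun t ht => AddCircle.liftIco_zero_coe_apply ht
  have hsurj (x : AddCircle L) : ∃ t ∈ Ico 0 L, ↑t = x := by
    simpa using (AddCircle.coe_image_Ico_eq L 0).ge (mem_univ x)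
  have hdist {s t : ℝ} (hs : s ∈ Ico 0 L) (ht : t ∈ Ico 0 L) :
      dist (f s) (f t) = dist (s : AddCircle L) t := by
    rcases le_total s t with h | h
    · rw [hf s t hs.1 h ht.2.le, dist_coe_addCircle hs.1 h ht.2.le]
    · rw [dist_comm, hf t s ht.1 h hs.2.le, dist_comm, dist_coe_addCircle ht.1 h hs.2.le]
  have hiso : Isometry (AddCircle.liftIco L 0 f) := by
    refine Isometry.of_dist_eq fun x y => ?_
    obtain ⟨s, hs, rfl⟩ := hsurj x
    obtain ⟨t, ht, rfl⟩ := hsurj y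
    exact (congrArg₂ dist (hlift hs) (hlift ht)).trans (hdist hs ht)
  refine ⟨⟨_, hiso.continuous⟩, hiso, fun t ht => ?_⟩
  rcases ht.2.eq_or_lt with rfl | htL
  · have hf0 : f 0 = f t := dist_eq_zero.1 (by simp [hf 0 t le_rfl hL.le le_rfl, hL.le])
    rw [← hf0, ← hlift ⟨le_rfl, hL⟩]
    simp [AddCircle.coe_period]
  · exact hlift ⟨ht.1, htL⟩

variable [MetricSpace X]

/-- A shortcut between two points of the loop splits it into two shorter loops, whose increments
are trivial. -/
theorem IsGeodesicSpace.min_le_dist (hX : IsGeodesicSpace X) (he : IsLocalCocycle r e)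
    (hL : L ∈ lowerBounds (nontrivialLoopLengths e)) (hf : LipschitzWith 1 f) (hfL : f 0 = f L)
    (hinc : increment e f 0 L ≠ 1) {s t : ℝ} (hs : 0 ≤ s) (hst : s ≤ t) (ht : t ≤ L) :
    min (t - s) (L - (t - s)) ≤ dist (f s) (f t) := by
  by_contra! hlt
  rw [lt_min_iff] at hlt
  have hex := he.exists_isPrimitive hf.uniformContinuous
  have hshortcut := hX.geodesicCocycle_mem_curveIncrements e (f s) (f t)
  have hinner : increment e f s t = hX.geodesicCocycle e (f s) (f t) :=
    (hX.geodesicCocycle_eq_increment he hL hf hst (by linarith)).symm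
  have houter : increment e f t L * increment e f 0 s = (hX.geodesicCocycle e (f s) (f t))⁻¹ := by
    refine he.eq_of_mem_curveIncrements hL (a := L - t + (s - 0))
      (he.mul_mem_curveIncrements (he.increment_mem_curveIncrements hf ht) ?_)
      (he.inv_mem_curveIncrements hshortcut) (by linarith)
    exact hfL ▸ he.increment_mem_curveIncrements hf hs
  apply hinc
  rw [← increment_mul_increment hex 0 s L, ← increment_mul_increment hex s t L, hinner,
    mul_eq_one_comm, mul_assoc, houter, mul_inv_cancel]

theorem IsGeodesicSpace.dist_eq_min (hX : IsGeodesicSpace X) (he : IsLocalCocycle r e)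
    (hL : L ∈ lowerBounds (nontrivialLoopLengths e)) (hf : LipschitzWith 1 f) (hfL : f 0 = f L)
    (hinc : increment e f 0 L ≠ 1) {s t : ℝ} (hs : 0 ≤ s) (hst : s ≤ t) (ht : t ≤ L) :
    dist (f s) (f t) = min (t - s) (L - (t - s)) := by
  refine le_antisymm (le_min ?_ ?_) (hX.min_le_dist he hL hf hfL hinc hs hst ht) <;>
    rw [lipschitzWith_one_iff_dist_le_sub] at hf
  · exact hf s t hst
  · calc dist (f s) (f t) ≤ dist (f 0) (f s) + dist (f t) (f L) := by
          rw [dist_comm (f 0), dist_comm (f t), ← hfL]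
          exact dist_triangle _ _ _
      _ ≤ (s - 0) + (L - t) := add_le_add (hf 0 s hs) (hf t L ht)
      _ = L - (t - s) := by ring

theorem isClosedGeodesic_of_isometry (hL : 0 < L) {c : C(AddCircle L, X)} (hc : Isometry c) :
    IsClosedGeodesic L c :=
  ⟨hL, 1, one_pos, fun s t _ => hc.dist_eq s t⟩

theorem IsGeodesicSpace.mem_nonNullGeodesicLengths (hX : IsGeodesicSpace X)
    (he : IsLocalCocycle r e) (hL : IsLeast (nontrivialLoopLengths e) L) :
    L ∈ nonNullGeodesicLengths X := by
  have hLpos := pos_of_mem_nontrivialLoopLengths hL.1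
  obtain ⟨x, _, ⟨-, f, hf, rfl, hfL, rfl⟩, hinc⟩ := hL.1
  obtain ⟨c, hc, hcf⟩ := exists_isometry_addCircle hLpos
    fun s t => hX.dist_eq_min he hL.2 hf hfL.symm hinc
  have hcoe := (lipschitzWith_coe_addCircle L).uniformContinuous
  have : Fact (0 < L) := ⟨hLpos⟩
  refine ⟨c, isClosedGeodesic_of_isometry hLpos hc, fun hnull => hinc ?_⟩
  rw [← increment_congr (he.exists_isPrimitive (hc.uniformContinuous.comp hcoe))
    (he.exists_isPrimitive hf.uniformContinuous) hLpos.le hcf]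
  exact increment_eq_one_of_nullhomotopic he hnull hcoe (by simp [AddCircle.coe_period])

end ShortestLoop

/-! ### Products of cocycles along chains -/

section ChainProd

variable {X G : Type*} [Group G] {e e' : X → X → G} {ε : ℝ}

/-- The product of `e` over the consecutive pairs of a chain, the discrete analogue of the
increment along a curve. -/
def chainProd (e : X → X → G) : List X → G
  | [] => 1
  | [_] => 1
  | x :: y :: l => e x y * chainProd e (y :: l)

@[simp]
theorem chainProd_singleton (x : X) : chainProd e [x] = 1 := rfl

@[simp]
theorem chainProd_cons_cons (x y : X) (l : List X) :
    chainProd e (x :: y :: l) = e x y * chainProd e (y :: l) := rfl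

theorem chainProd_append_cons (l₁ : List X) (x : X) (l₂ : List X) :
    chainProd e (l₁ ++ x :: l₂) = chainProd e (l₁ ++ [x]) * chainProd e (x :: l₂) := by
  induction l₁ with
  | nil => simp
  | cons a l ih =>
    cases l with
    | nil => simp
    | cons b l =>
      simp only [List.cons_append, chainProd_cons_cons, mul_assoc] at ih ⊢
      rw [ih]

theorem chainProd_congr {R : X → X → Prop} {α : List X} (hα : α.IsChain R)
    (h : ∀ x y, R x y → e x y = e' x y) : chainProd e α = chainProd e' α := by
  induction hα with
  | nil => rfl
  | singleton => rfl
  | cons_cons hxy _ ih => rw [chainProd_cons_cons, chainProd_cons_cons, h _ _ hxy, ih]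

variable [MetricSpace X]

theorem BasicMove.symm {α β : List X} (h : BasicMove ε α β) : BasicMove ε β α :=
  ⟨h.2.1, h.1, h.2.2.1.symm, h.2.2.2.1.symm, h.2.2.2.2.symm⟩

theorem IsLocalCocycle.chainProd_eq_of_insertsPoint (he : IsLocalCocycle ε e) {α β : List X}
    (h : BasicMove ε α β) (hαβ : InsertsPoint α β) : chainProd e α = chainProd e β := by
  obtain ⟨l₁, l₂, x, rfl, rfl⟩ := hαβ
  obtain ⟨⟨hne, hα⟩, ⟨-, hβ⟩, hhead, hlast, -⟩ := h
  rcases l₁.eq_nil_or_concat' with rfl | ⟨l₁, a, rfl⟩ <;> rcases l₂ with _ | ⟨b, l₂⟩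
  · simp at hne
  · obtain rfl : b = x := by simpa using hhead
    simp [he.self]
  · obtain rfl : a = x := by simpa using hlast
    simp [chainProd_append_cons l₁ a [a], he.self]
  · simp only [List.append_assoc, List.cons_append, List.nil_append] at hα hβ ⊢
    have hab := List.isChain_cons_cons.1 (List.isChain_append.1 hα).2.1
    have hax := List.isChain_cons_cons.1 (List.isChain_append.1 hβ).2.1
    have hxb := List.isChain_cons_cons.1 hax.2
    rw [chainProd_append_cons l₁ a (b :: l₂), chainProd_append_cons l₁ a (x :: b :: l₂),
      chainProd_cons_cons, chainProd_cons_cons, chainProd_cons_cons, ← he.mul hax.1 hxb.1 hab.1,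
      mul_assoc]

theorem IsLocalCocycle.chainProd_eq_of_basicMove (he : IsLocalCocycle ε e) {α β : List X}
    (h : BasicMove ε α β) : chainProd e α = chainProd e β :=
  h.2.2.2.2.elim (he.chainProd_eq_of_insertsPoint h)
    fun hβα => (he.chainProd_eq_of_insertsPoint h.symm hβα).symm

theorem IsLocalCocycle.chainProd_eq_of_epsHomotopic (he : IsLocalCocycle ε e) {α β : List X}
    (h : EpsHomotopic ε α β) : chainProd e α = chainProd e β := by
  obtain ⟨-, -, h⟩ := h
  induction h with
  | refl => rfl
  | tail _ hmove ih => exact ih.trans (he.chainProd_eq_of_basicMove hmove)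

end ChainProd

/-! ### The cocycle of `ε`-homotopy classes of chains -/

section ChainFiber

variable {X : Type*} [MetricSpace X] {ε : ℝ} {x y z : X}

/-- The `ε`-homotopy classes of `ε`-chains `x :: l` with fixed initial point `x`; a chain is
encoded by its tail `l`. -/
def ChainFiber (ε : ℝ) (x : X) : Type _ :=
  Quot fun l l' : {l : List X // IsEpsChain ε (x :: l)} => BasicMove ε (x :: l.1) (x :: l'.1)

namespace ChainFiber

/-- The class of the chain `x :: l`. -/
def mk (l : List X) (h : IsEpsChain ε (x :: l)) : ChainFiber ε x :=
  Quot.mk _ ⟨l, h⟩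

theorem mk_eq_mk {l l' : List X} (h : BasicMove ε (x :: l) (x :: l')) :
    mk l h.1 = mk l' h.2.1 :=
  Quot.sound h

theorem epsHomotopic_of_mk_eq_mk {l l' : List X} {h : IsEpsChain ε (x :: l)}
    {h' : IsEpsChain ε (x :: l')} (heq : mk l h = mk l' h') :
    EpsHomotopic ε (x :: l) (x :: l') := by
  have : Std.Symm fun l l' : {l : List X // IsEpsChain ε (x :: l)} =>
    BasicMove ε (x :: l.1) (x :: l'.1) := ⟨fun _ _ => BasicMove.symm⟩
  have hgen := Quot.eqvGen_exact heq
  rw [Relation.EqvGen.eqvGen_eq_reflTransGen] at hgen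
  exact ⟨h, h', hgen.lift (List.cons x ∘ Subtype.val) fun _ _ => id⟩

end ChainFiber

theorem IsEpsChain.singleton (ε : ℝ) (x : X) : IsEpsChain ε [x] :=
  ⟨by simp, List.isChain_singleton x⟩

theorem IsEpsChain.cons {l : List X} (hl : IsEpsChain ε (y :: l)) (h : dist x y < ε) :
    IsEpsChain ε (x :: y :: l) :=
  ⟨by simp, List.isChain_cons_cons.2 ⟨h, hl.2⟩⟩

theorem BasicMove.cons {l l' : List X} (h : BasicMove ε (y :: l) (y :: l')) (hxy : dist x y < ε) :
    BasicMove ε (x :: y :: l) (x :: y :: l') := by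
  obtain ⟨hl, hl', -, hlast, hins⟩ := h
  refine ⟨hl.cons hxy, hl'.cons hxy, rfl, by simpa using hlast, hins.imp ?_ ?_⟩ <;>
  · rintro ⟨l₁, l₂, z, h₁, h₂⟩
    exact ⟨x :: l₁, l₂, z, by rw [h₁, List.cons_append], by rw [h₂, List.cons_append]⟩

theorem basicMove_remove_second {l : List X} (h : IsEpsChain ε (x :: y :: z :: l))
    (hxz : dist x z < ε) : BasicMove ε (x :: y :: z :: l) (x :: z :: l) :=
  ⟨h, ⟨by simp, h.2.tail.tail.cons_cons hxz⟩, rfl, by simp, .inr ⟨[x], z :: l, y, rfl, rfl⟩⟩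

theorem basicMove_remove_duplicate {l : List X} (h : IsEpsChain ε (x :: x :: l)) :
    BasicMove ε (x :: x :: l) (x :: l) :=
  ⟨h, ⟨by simp, h.2.tail⟩, rfl, by simp, .inr ⟨[], x :: l, x, rfl, rfl⟩⟩

namespace ChainFiber

/-- Prepending the point `x` to chains starting at `y`. -/
def cons (h : dist x y < ε) : ChainFiber ε y → ChainFiber ε x :=
  Quot.map (fun l => ⟨y :: l.1, l.2.cons h⟩) fun _ _ hmove => hmove.cons h

theorem cons_cons (hxy : dist x y < ε) (hyz : dist y z < ε) (hxz : dist x z < ε)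
    (q : ChainFiber ε z) : cons hxy (cons hyz q) = cons hxz q := by
  obtain ⟨l, hl⟩ := q
  exact mk_eq_mk (basicMove_remove_second ((hl.cons hyz).cons hxy) hxz)

theorem cons_self (h : dist x x < ε) (q : ChainFiber ε x) : cons h q = q := by
  obtain ⟨l, hl⟩ := q
  exact mk_eq_mk (basicMove_remove_duplicate (hl.cons h))

/-- Prepending a point is a bijection, with inverse prepending the other point. -/
def consEquiv (hε : 0 < ε) (h : dist x y < ε) : ChainFiber ε y ≃ ChainFiber ε x where
  toFun := cons h
  invFun := cons ((dist_comm y x).trans_lt h)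
  left_inv q := by rw [cons_cons _ _ (by rwa [dist_self]), cons_self]
  right_inv q := by rw [cons_cons _ _ (by rwa [dist_self]), cons_self]

theorem nonempty_equiv [PreconnectedSpace X] (hε : 0 < ε) (x y : X) :
    Nonempty (ChainFiber ε x ≃ ChainFiber ε y) := by
  have hstep : ∀ᶠ p in 𝓤 X, Nonempty (ChainFiber ε x ≃ ChainFiber ε p.1) =
      Nonempty (ChainFiber ε x ≃ ChainFiber ε p.2) := by
    filter_upwards [Metric.dist_mem_uniformity hε] with p hp
    exact propext ⟨fun ⟨σ⟩ => ⟨σ.trans (consEquiv hε hp).symm⟩,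
      fun ⟨σ⟩ => ⟨σ.trans (consEquiv hε hp)⟩⟩
  exact (eq_of_eventually_uniformity_eq
    (φ := fun y => Nonempty (ChainFiber ε x ≃ ChainFiber ε y)) hstep x y).mp ⟨Equiv.refl _⟩

/-- A chosen identification of the classes of chains starting at `x` with those starting at the
base point `x₀`. -/
def trivialization [PreconnectedSpace X] (hε : 0 < ε) (x₀ x : X) :
    ChainFiber ε x ≃ ChainFiber ε x₀ :=
  (nonempty_equiv hε x x₀).some

end ChainFiber

open Classical in
/-- The local cocycle that records, in fixed trivializations, how prepending points permutes the
`ε`-homotopy classes of chains. It has the junk value `1` for points at distance `≥ ε`. -/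
def chainCocycle [PreconnectedSpace X] (hε : 0 < ε) (x₀ x y : X) :
    Equiv.Perm (ChainFiber ε x₀) :=
  if h : dist x y < ε then
    (ChainFiber.trivialization hε x₀ y).symm.trans
      ((ChainFiber.consEquiv hε h).trans (ChainFiber.trivialization hε x₀ x))
  else 1

variable [PreconnectedSpace X] {x₀ : X}

theorem chainCocycle_trivialization (hε : 0 < ε) (h : dist x y < ε) (q : ChainFiber ε y) :
    chainCocycle hε x₀ x y (ChainFiber.trivialization hε x₀ y q) =
      ChainFiber.trivialization hε x₀ x (ChainFiber.cons h q) := by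
  simp [chainCocycle, h, ChainFiber.consEquiv]

theorem isLocalCocycle_chainCocycle (hε : 0 < ε) (x₀ : X) :
    IsLocalCocycle ε (chainCocycle hε x₀) where
  pos := hε
  mul {x y z} hxy hyz hxz := by
    ext q
    obtain ⟨q, rfl⟩ := (ChainFiber.trivialization hε x₀ z).surjective q
    rw [Equiv.Perm.mul_apply, chainCocycle_trivialization hε hyz,
      chainCocycle_trivialization hε hxy, chainCocycle_trivialization hε hxz,
      ChainFiber.cons_cons hxy hyz hxz]

theorem chainProd_chainCocycle_trivialization (hε : 0 < ε) {l : List X}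
    (hl : IsEpsChain ε (x :: l)) (hy : (x :: l).getLast? = some y) :
    chainProd (chainCocycle hε x₀) (x :: l)
        (ChainFiber.trivialization hε x₀ y (ChainFiber.mk [] (.singleton ε y))) =
      ChainFiber.trivialization hε x₀ x (ChainFiber.mk l hl) := by
  induction l generalizing x with
  | nil =>
    obtain rfl : x = y := by simpa using hy
    rfl
  | cons z l ih =>
    have hxz := List.isChain_cons_cons.1 hl.2
    rw [chainProd_cons_cons, Equiv.Perm.mul_apply, ih ⟨by simp, hxz.2⟩ (by simpa using hy),
      chainCocycle_trivialization hε hxz.1]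
    rfl

theorem IsEpsLoop.isEpsNull_of_chainProd_eq_one (hε : 0 < ε) {α : List X} (hα : IsEpsLoop ε x α)
    (hprod : chainProd (chainCocycle hε x₀) α = 1) : IsEpsNull ε x α := by
  obtain ⟨hchain, hhead, hlast⟩ := hα
  obtain ⟨l, rfl⟩ := List.head?_eq_some_iff.1 hhead
  have hmk := chainProd_chainCocycle_trivialization (x₀ := x₀) hε hchain hlast
  rw [hprod, Equiv.Perm.one_apply] at hmk
  exact ChainFiber.epsHomotopic_of_mk_eq_mk
    ((ChainFiber.trivialization hε x₀ x).injective hmk).symm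

end ChainFiber

/-! ### The lower bound for the homotopy critical spectrum -/

section LowerBound

variable {X : Type*} [MetricSpace X] {ε : ℝ}

/-- A path along a geodesic from `x` to `y`. -/
def IsGeodesicSpace.geodesicPath (hX : IsGeodesicSpace X) (x y : X) : Path x y where
  toFun t := hX.geodesic x y (t * dist x y)
  continuous_toFun := (hX.lipschitzWith_geodesic x y).continuous.comp (by fun_prop)
  source' := by simp
  target' := by simp

theorem IsGeodesicSpace.pathConnectedSpace (hX : IsGeodesicSpace X) [Nonempty X] :
    PathConnectedSpace X :=
  ⟨‹_›, fun x y => ⟨hX.geodesicPath x y⟩⟩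

theorem IsEpsCritical.not_mem_lowerBounds [PreconnectedSpace X] (hX : IsGeodesicSpace X)
    (hε : 0 < ε) {x : X} {α : List X} (hα : IsEpsCritical ε x α) {δ : ℝ} (hδ : ε < δ) :
    3 * δ ∉ lowerBounds (nontrivialLoopLengths (chainCocycle hε x)) := by
  intro hlower
  obtain ⟨hloop, hnot, hnull⟩ := hα
  have he := isLocalCocycle_chainCocycle hε x
  refine hnot (hloop.isEpsNull_of_chainProd_eq_one (x₀ := x) hε ?_)
  calc chainProd (chainCocycle hε x) α = chainProd (hX.geodesicCocycle (chainCocycle hε x)) α :=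
        (chainProd_congr hloop.1.2 fun y z hyz => hX.geodesicCocycle_eq he hyz).symm
    _ = chainProd (hX.geodesicCocycle (chainCocycle hε x)) [x] :=
        (hX.isLocalCocycle_geodesicCocycle he (hε.trans hδ) hlower).chainProd_eq_of_epsHomotopic
          (hnull δ hδ)
    _ = 1 := chainProd_singleton x

theorem IsEpsCritical.exists_mem_nonNullGeodesicLengths_le [CompactSpace X]
    (hX : IsGeodesicSpace X) (hε : 0 < ε) {x : X} {α : List X} (hα : IsEpsCritical ε x α) :
    ∃ L ∈ nonNullGeodesicLengths X, L ≤ 3 * ε := by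
  have : Nonempty X := ⟨x⟩
  have := hX.pathConnectedSpace
  have he := isLocalCocycle_chainCocycle hε x
  have hne : (nontrivialLoopLengths (chainCocycle hε x)).Nonempty := by
    by_contra! hempty
    exact hα.not_mem_lowerBounds hX hε (lt_add_one ε) (by simp [hempty])
  obtain ⟨L, hL⟩ := he.exists_isLeast_nontrivialLoopLengths hne
  refine ⟨L, hX.mem_nonNullGeodesicLengths he hL, ?_⟩
  by_contra! hlt
  refine hα.not_mem_lowerBounds hX hε (δ := L / 3) (by linarith) ?_
  rw [mul_div_cancel₀ L three_ne_zero]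
  exact hL.2

theorem oneSystole_div_three_le [CompactSpace X] (hX : IsGeodesicSpace X)
    (hε : ε ∈ homotopyCriticalSpectrum X) : oneSystole X / 3 ≤ ENNReal.ofReal ε := by
  obtain ⟨hε0, x, α, hα⟩ := hε
  obtain ⟨L, hL, hLε⟩ := hα.exists_mem_nonNullGeodesicLengths_le hX hε0
  refine ENNReal.div_le_of_le_mul ?_
  calc oneSystole X ≤ ENNReal.ofReal L := iInf₂_le L hL
    _ ≤ ENNReal.ofReal (ε * 3) := ENNReal.ofReal_le_ofReal (by linarith)
    _ = ENNReal.ofReal ε * 3 := by rw [ENNReal.ofReal_mul hε0.le, ENNReal.ofReal_ofNat]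

end LowerBound

/-! ### The cocycle of homotopy classes of paths -/

section PathClass

variable {X : Type*} [TopologicalSpace X] {x y z : X}

theorem symm_trans_cancel_left (p : Path.Homotopic.Quotient x y)
    (q : Path.Homotopic.Quotient y z) : p.symm.trans (p.trans q) = q := by
  rw [← Path.Homotopic.Quotient.trans_assoc, Path.Homotopic.Quotient.symm_trans,
    Path.Homotopic.Quotient.refl_trans]

theorem homotopic_of_trans_symm_homotopic_refl {γ γ' : Path x y}
    (h : (γ.trans γ'.symm).Homotopic (Path.refl x)) : γ.Homotopic γ' := by
  rw [← Path.Homotopic.Quotient.eq] at h ⊢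
  simpa using congrArg (Path.Homotopic.Quotient.trans · (.mk γ')) h

variable [PathConnectedSpace X] {x₀ : X}

/-- The class of a path in the fundamental group at `x₀`, after joining its endpoints to `x₀` by
chosen paths. The opposite group is used because `FundamentalGroup` multiplies loops from right
to left. -/
def pathClass (x₀ : X) (γ : Path x y) : (FundamentalGroup X x₀)ᵐᵒᵖ :=
  .op (((Path.Homotopic.Quotient.mk (PathConnectedSpace.somePath x₀ x)).trans (.mk γ)).trans
    (Path.Homotopic.Quotient.mk (PathConnectedSpace.somePath x₀ y)).symm)

theorem pathClass_eq_pathClass_iff {γ γ' : Path x y} :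
    pathClass x₀ γ = pathClass x₀ γ' ↔ γ.Homotopic γ' := by
  rw [← Path.Homotopic.Quotient.eq]
  refine ⟨fun h => ?_, fun h => by rw [pathClass, h, pathClass]⟩
  have hconj := congrArg
    (fun q => (Path.Homotopic.Quotient.mk (PathConnectedSpace.somePath x₀ x)).symm.trans
      (q.trans (Path.Homotopic.Quotient.mk (PathConnectedSpace.somePath x₀ y))))
    (MulOpposite.op_injective h)
  simpa [symm_trans_cancel_left] using hconj

theorem pathClass_trans (γ : Path x y) (γ' : Path y z) :
    pathClass x₀ (γ.trans γ') = pathClass x₀ γ * pathClass x₀ γ' := by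
  simp only [pathClass, ← MulOpposite.op_mul, FundamentalGroup.mul_def]
  simp [symm_trans_cancel_left]

theorem pathClass_refl (x : X) : pathClass x₀ (Path.refl x) = 1 := by
  rw [← mul_eq_left (a := pathClass x₀ (Path.refl x)), ← pathClass_trans, Path.refl_trans_refl]

theorem pathClass_eq_one_iff {γ : Path x x} :
    pathClass x₀ γ = 1 ↔ γ.Homotopic (Path.refl x) := by
  rw [← pathClass_refl x, pathClass_eq_pathClass_iff]

theorem pathClass_cast (γ : Path x y) {x' y' : X} (hx : x' = x) (hy : y' = y) :
    pathClass x₀ (γ.cast hx hy) = pathClass x₀ γ := by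
  subst hx hy
  rfl

end PathClass

section PathCocycle

variable {X : Type*} [MetricSpace X] {R : ℝ}

variable (X) in
/-- Paths with the same endpoints that lie in a common ball of radius `R` are homotopic: a uniform
form of semilocal simple connectedness. -/
def BallPathsHomotopic (R : ℝ) : Prop :=
  ∀ (z : X) {x y : X} {γ γ' : Path x y}, range γ ⊆ Metric.ball z R → range γ' ⊆ Metric.ball z R →
    γ.Homotopic γ'

theorem SemilocallySimplyConnected.exists_ballPathsHomotopic [CompactSpace X]
    (hs : SemilocallySimplyConnected X) : ∃ R > 0, BallPathsHomotopic X R := by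
  choose U hU hxU hnull using hs
  obtain ⟨R, hR, hball⟩ := lebesgue_number_lemma_of_metric (isCompact_univ (X := X)) hU
    fun x _ => mem_iUnion.2 ⟨x, hxU x⟩
  refine ⟨R, hR, fun z x y γ γ' hγ hγ' => homotopic_of_trans_symm_homotopic_refl ?_⟩
  obtain ⟨i, hi⟩ := hball z (mem_univ z)
  refine hnull i _ _ ?_
  rw [Path.trans_range, Path.symm_range]
  exact union_subset (hγ.trans hi) (hγ'.trans hi)

theorem IsGeodesicSpace.range_geodesicPath_subset_ball (hX : IsGeodesicSpace X) {x y z : X}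
    (h : dist x z + dist x y < R) : range (hX.geodesicPath x y) ⊆ Metric.ball z R := by
  rintro _ ⟨t, rfl⟩
  have hnonneg : 0 ≤ t * dist x y := mul_nonneg t.2.1 dist_nonneg
  have hdist : dist (hX.geodesicPath x y t) x ≤ t * dist x y := by
    simpa [dist_comm x, IsGeodesicSpace.geodesicPath] using lipschitzWith_one_iff_dist_le_sub.1
      (hX.lipschitzWith_geodesic x y) 0 (t * dist x y) hnonneg
  calc dist (hX.geodesicPath x y t) z ≤ dist (hX.geodesicPath x y t) x + dist x z :=
        dist_triangle _ _ _
    _ ≤ dist x y + dist x z :=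
        add_le_add_left (hdist.trans (mul_le_of_le_one_left dist_nonneg t.2.2)) _
    _ < R := by rwa [add_comm]

variable [PathConnectedSpace X] {x₀ : X}

/-- The local cocycle of classes of geodesics in the fundamental group. -/
def IsGeodesicSpace.pathCocycle (hX : IsGeodesicSpace X) (x₀ x y : X) :
    (FundamentalGroup X x₀)ᵐᵒᵖ :=
  pathClass x₀ (hX.geodesicPath x y)

namespace BallPathsHomotopic

theorem isLocalCocycle_pathCocycle (hR : 0 < R) (hball : BallPathsHomotopic X R)
    (hX : IsGeodesicSpace X) (x₀ : X) : IsLocalCocycle (R / 2) (hX.pathCocycle x₀) where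
  pos := half_pos hR
  mul {x y z} hxy hyz hxz := by
    rw [IsGeodesicSpace.pathCocycle, IsGeodesicSpace.pathCocycle, ← pathClass_trans]
    refine pathClass_eq_pathClass_iff.2 (hball x ?_ ?_)
    · rw [Path.trans_range]
      exact union_subset (hX.range_geodesicPath_subset_ball (by rw [dist_self]; linarith))
        (hX.range_geodesicPath_subset_ball (by rw [dist_comm y x]; linarith))
    · exact hX.range_geodesicPath_subset_ball (by rw [dist_self]; linarith)

theorem isPrimitive_subpath (hR : 0 < R) (hball : BallPathsHomotopic X R)
    (hX : IsGeodesicSpace X) {x y : X} (γ : Path x y) :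
    IsPrimitive (hX.pathCocycle x₀) γ fun t => pathClass x₀ (γ.subpath 0 t) := by
  obtain ⟨η, hη, hγη⟩ := Metric.uniformContinuous_iff.1
    (CompactSpace.uniformContinuous_of_continuous γ.continuous) R hR
  filter_upwards [Metric.dist_mem_uniformity hη] with ⟨s, t⟩ hst
  rw [← pathClass_eq_pathClass_iff.2 ⟨Path.Homotopy.subpathTransSubpath γ 0 s t⟩, pathClass_trans]
  refine congrArg _ (pathClass_eq_pathClass_iff.2 (hball (γ s) ?_ ?_))
  · exact hX.range_geodesicPath_subset_ball (by rw [dist_self, zero_add]; exact hγη hst)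
  · rw [Path.range_subpath]
    rintro _ ⟨u, hu, rfl⟩
    refine hγη (lt_of_le_of_lt ?_ hst)
    rw [dist_comm]
    exact Real.dist_left_le_of_mem_uIcc (mem_uIcc.2 (mem_uIcc.1 hu))

theorem increment_pathCocycle (hR : 0 < R) (hball : BallPathsHomotopic X R)
    (hX : IsGeodesicSpace X) {x y : X} (γ : Path x y) :
    increment (hX.pathCocycle x₀) γ 0 1 = pathClass x₀ γ := by
  rw [(hball.isPrimitive_subpath hR hX γ).increment_eq, Path.subpath_self, pathClass_refl, inv_one,
    one_mul, Path.subpath_zero_one, pathClass_cast]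

end BallPathsHomotopic

end PathCocycle

/-! ### Closed geodesics that are not null-homotopic -/

section ClosedGeodesic

/-- The loop that traverses a circle map once, starting at the image of `0`. -/
def circleLoop {X : Type*} [TopologicalSpace X] {L : ℝ} (c : C(AddCircle L, X)) :
    Path (c 0) (c 0) where
  toFun t := c ((L * t : ℝ) : AddCircle L)
  continuous_toFun := c.continuous.comp ((AddCircle.continuous_mk' L).comp (by fun_prop))
  source' := by simp
  target' := by simp [AddCircle.coe_period]

theorem nullhomotopic_of_circleLoop_homotopic_refl {X : Type*} [TopologicalSpace X] {L : ℝ}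
    (hL : 0 < L) {c : C(AddCircle L, X)} (h : (circleLoop c).Homotopic (Path.refl (c 0))) :
    c.Nullhomotopic := by
  have : Fact (0 < L) := ⟨hL⟩
  obtain ⟨H⟩ := h
  let f : C(ℝ, C(unitInterval, X)) := ContinuousMap.curry
    ⟨fun p => H (p.2, projIcc 0 1 zero_le_one (p.1 / L)), by fun_prop⟩
  have hf : f 0 = f L := by
    ext τ
    simp [f, hL.ne']
  let F : C(AddCircle L, C(unitInterval, X)) :=
    ⟨AddCircle.liftIco L 0 f, AddCircle.liftIco_zero_continuous hf f.continuous.continuousOn⟩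
  have hF (p : AddCircle L) : ∃ t : unitInterval, ((L * t : ℝ) : AddCircle L) = p ∧
      ∀ τ, F p τ = H (τ, t) := by
    obtain ⟨s, hs, rfl⟩ := (AddCircle.coe_image_Ico_eq L 0).ge (mem_univ p)
    rw [zero_add] at hs
    have hsL : s / L ∈ Icc (0 : ℝ) 1 := ⟨div_nonneg hs.1 hL.le, (div_le_one hL).2 hs.2.le⟩
    refine ⟨⟨s / L, hsL⟩, by simp [mul_div_cancel₀, hL.ne'], fun τ => ?_⟩
    simp [F, AddCircle.liftIco_zero_coe_apply hs, f, projIcc_of_mem _ hsL]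
  refine ⟨c 0, ⟨⟨⟨fun q => F q.2 q.1, by fun_prop⟩, fun p => ?_, fun p => ?_⟩⟩⟩
  · obtain ⟨t, rfl, ht⟩ := hF p
    exact (ht 0).trans (H.apply_zero t)
  · obtain ⟨t, rfl, ht⟩ := hF p
    exact (ht 1).trans (H.apply_one t)

variable {X : Type*} [MetricSpace X] {L R r : ℝ}

theorem lipschitzWith_one_of_forall_sub_le {f : ℝ → X} (hr : 0 < r)
    (hf : ∀ s t, s ≤ t → t - s ≤ r → dist (f s) (f t) ≤ t - s) : LipschitzWith 1 f := by
  have hmul (n : ℕ) : ∀ s t, s ≤ t → t - s ≤ n * r → dist (f s) (f t) ≤ t - s := by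
    induction n with
    | zero =>
      intro s t hst hle
      exact hf s t hst (hle.trans (by simpa using hr.le))
    | succ n ih =>
      intro s t hst hle
      push_cast at hle
      rcases le_total (t - s) r with h | h
      · exact hf s t hst h
      calc dist (f s) (f t) ≤ dist (f s) (f (t - r)) + dist (f (t - r)) (f t) :=
            dist_triangle _ _ _
        _ ≤ (t - r - s) + (t - (t - r)) :=
            add_le_add (ih _ _ (by linarith) (by linarith)) (hf _ _ (by linarith) (by linarith))
        _ = t - s := by ring
  refine lipschitzWith_one_iff_dist_le_sub.2 fun s t hst => ?_
  obtain ⟨n, hn⟩ := exists_nat_ge ((t - s) / r)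
  exact hmul n s t hst ((div_le_iff₀ hr).1 hn)

theorem IsClosedGeodesic.lipschitzWith_comp_coe {c : C(AddCircle L, X)}
    (hc : IsClosedGeodesic L c) : LipschitzWith 1 (c ∘ ((↑) : ℝ → AddCircle L)) := by
  obtain ⟨-, r, hr, hcr⟩ := hc
  refine lipschitzWith_one_of_forall_sub_le (half_pos hr) fun s t hst hstr => ?_
  have hcoe := lipschitzWith_one_iff_dist_le_sub.1 (lipschitzWith_coe_addCircle L) s t hst
  exact (hcr s t (by linarith)).trans_le hcoe

theorem BallPathsHomotopic.nonNullGeodesicLengths_subset [PathConnectedSpace X] (hR : 0 < R)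
    (hball : BallPathsHomotopic X R) (hX : IsGeodesicSpace X) (x₀ : X) :
    nonNullGeodesicLengths X ⊆ nontrivialLoopLengths (hX.pathCocycle x₀) := by
  rintro L ⟨c, hc, hnull⟩
  have he := hball.isLocalCocycle_pathCocycle hR hX x₀
  have hLip := hc.lipschitzWith_comp_coe
  have hinc : increment (hX.pathCocycle x₀) (c ∘ ((↑) : ℝ → AddCircle L)) 0 L =
      pathClass x₀ (circleLoop c) := by
    have hcomp := increment_comp (he.exists_isPrimitive hLip.uniformContinuous)
      (φ := fun t : unitInterval => L * t)
      (CompactSpace.uniformContinuous_of_continuous (by fun_prop)) 0 1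
    have hloop : ⇑(circleLoop c) =
        (c ∘ ((↑) : ℝ → AddCircle L)) ∘ fun t : unitInterval => L * t := rfl
    rw [← hball.increment_pathCocycle hR hX, hloop, hcomp]
    simp
  refine ⟨c 0, _, ⟨hc.1.le, _, hLip, by simp, by simp [AddCircle.coe_period], hinc⟩, fun h => ?_⟩
  exact hnull (nullhomotopic_of_circleLoop_homotopic_refl hc.1 (pathClass_eq_one_iff.1 h))

theorem oneSystole_eq_ofReal (hL : IsLeast (nonNullGeodesicLengths X) L) :
    oneSystole X = ENNReal.ofReal L :=
  le_antisymm (iInf₂_le L hL.1) (le_iInf₂ fun _ h => ENNReal.ofReal_le_ofReal (hL.2 h))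

theorem BallPathsHomotopic.nontrivialLoopLengths_pathCocycle_nonempty [PathConnectedSpace X]
    (hR : 0 < R) (hball : BallPathsHomotopic X R) (hX : IsGeodesicSpace X) (x₀ : X)
    (hn : ¬ SimplyConnectedSpace X) : (nontrivialLoopLengths (hX.pathCocycle x₀)).Nonempty := by
  rw [simply_connected_iff_loops_nullhomotopic] at hn
  push Not at hn
  obtain ⟨x, γ, hγ⟩ := hn ‹_›
  refine hX.nontrivialLoopLengths_nonempty (hball.isLocalCocycle_pathCocycle hR hX x₀)
    (CompactSpace.uniformContinuous_of_continuous γ.continuous)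
    (γ.source.trans γ.target.symm) ?_
  rwa [hball.increment_pathCocycle hR hX, Ne, pathClass_eq_one_iff]

end ClosedGeodesic

/-! ### The critical loop on a shortest circle -/

section Hexagon

variable {X G : Type*} [MetricSpace X] [Group G] {r L ε : ℝ} {e : X → X → G} {f : ℝ → X}

/-- Removing `x₁`, `x₃` and `x₅` leaves the triangle with vertices `x₀`, `x₂` and `x₄`. -/
theorem isEpsNull_hexagon {x₀ x₁ x₂ x₃ x₄ x₅ : X}
    (h : IsEpsChain ε [x₀, x₁, x₂, x₃, x₄, x₅, x₀]) (h₀₂ : dist x₀ x₂ < ε) (h₂₄ : dist x₂ x₄ < ε)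
    (h₄₀ : dist x₄ x₀ < ε) : IsEpsNull ε x₀ [x₀, x₁, x₂, x₃, x₄, x₅, x₀] := by
  obtain ⟨h₀₁, h₁₂, h₂₃, h₃₄, h₄₅, h₅₀⟩ : dist x₀ x₁ < ε ∧ dist x₁ x₂ < ε ∧ dist x₂ x₃ < ε ∧
    dist x₃ x₄ < ε ∧ dist x₄ x₅ < ε ∧ dist x₅ x₀ < ε := by simpa using h.2
  have h₂₀ : dist x₂ x₀ < ε := by rwa [dist_comm]
  have h₀₀ : dist x₀ x₀ < ε := by simpa using dist_nonneg.trans_lt h₀₂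
  let q : ChainFiber ε x₀ := .mk [] (.singleton ε x₀)
  refine ChainFiber.epsHomotopic_of_mk_eq_mk (h := h) (h' := .singleton ε x₀) ?_
  calc ChainFiber.mk [x₁, x₂, x₃, x₄, x₅, x₀] h
      = .cons h₀₁ (.cons h₁₂ (.cons h₂₃ (.cons h₃₄ (.cons h₄₅ (.cons h₅₀ q))))) := rfl
    _ = .cons h₀₂ (.cons h₂₄ (.cons h₄₀ q)) := by
        rw [ChainFiber.cons_cons h₀₁ h₁₂ h₀₂, ChainFiber.cons_cons h₂₃ h₃₄ h₂₄,
          ChainFiber.cons_cons h₄₅ h₅₀ h₄₀]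
    _ = q := by
        rw [ChainFiber.cons_cons h₂₄ h₄₀ h₂₀, ChainFiber.cons_cons h₀₂ h₂₀ h₀₀,
          ChainFiber.cons_self]

/-- Seven equidistant points on a curve of length `L`, hence the vertices of a hexagon if the
curve is closed. -/
def inscribedHexagon (f : ℝ → X) (L : ℝ) : List X :=
  [f 0, f (L / 6), f (L / 3), f (L / 2), f (2 * L / 3), f (5 * L / 6), f L]

theorem isEpsChain_inscribedHexagon (hL : 0 < L) (hf : LipschitzWith 1 f) (hε : L / 3 ≤ ε) :
    IsEpsChain ε (inscribedHexagon f L) := by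
  rw [lipschitzWith_one_iff_dist_le_sub] at hf
  refine ⟨by simp [inscribedHexagon], ?_⟩
  simp only [inscribedHexagon, List.isChain_cons_cons, List.isChain_singleton, and_true]
  refine ⟨?_, ?_, ?_, ?_, ?_, ?_⟩ <;> exact (hf _ _ (by linarith)).trans_lt (by linarith)

theorem isEpsNull_inscribedHexagon (hL : 0 < L) (hf : LipschitzWith 1 f) (hfL : f 0 = f L)
    (hε : L / 3 < ε) : IsEpsNull ε (f 0) (inscribedHexagon f L) := by
  have hchain := isEpsChain_inscribedHexagon hL hf hε.le
  rw [inscribedHexagon, ← hfL] at hchain ⊢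
  rw [lipschitzWith_one_iff_dist_le_sub] at hf
  refine isEpsNull_hexagon hchain ?_ ?_ (hfL ▸ ?_) <;>
    exact (hf _ _ (by linarith)).trans_lt (by linarith)

theorem IsGeodesicSpace.chainProd_inscribedHexagon (hX : IsGeodesicSpace X)
    (he : IsLocalCocycle r e) (hL : L ∈ lowerBounds (nontrivialLoopLengths e)) (hLpos : 0 < L)
    (hf : LipschitzWith 1 f) :
    chainProd (hX.geodesicCocycle e) (inscribedHexagon f L) = increment e f 0 L := by
  have hside {s t : ℝ} (hst : s ≤ t) (hstL : t - s ≤ L / 6) :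
      hX.geodesicCocycle e (f s) (f t) = increment e f s t := by
    have hdist := lipschitzWith_one_iff_dist_le_sub.1 hf s t hst
    exact hX.geodesicCocycle_eq_increment he hL hf hst (by linarith)
  simp only [inscribedHexagon, chainProd_cons_cons, chainProd_singleton, mul_one]
  repeat rw [hside (by linarith) (by linarith)]
  simp only [increment_mul_increment (he.exists_isPrimitive hf.uniformContinuous)]

theorem IsGeodesicSpace.div_three_mem_homotopyCriticalSpectrum (hX : IsGeodesicSpace X)
    (he : IsLocalCocycle r e) (hL : IsLeast (nontrivialLoopLengths e) L) :
    L / 3 ∈ homotopyCriticalSpectrum X := by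
  have hLpos := pos_of_mem_nontrivialLoopLengths hL.1
  obtain ⟨_, _, ⟨-, f, hf, rfl, hfL, rfl⟩, hinc⟩ := hL.1
  refine ⟨by positivity, f 0, inscribedHexagon f L, ⟨isEpsChain_inscribedHexagon hLpos hf le_rfl,
    rfl, by simp [inscribedHexagon, hfL]⟩, fun hnull => hinc ?_, fun δ hδ =>
    isEpsNull_inscribedHexagon hLpos hf hfL.symm hδ⟩
  have hcocycle : IsLocalCocycle (L / 3) (hX.geodesicCocycle e) :=
    hX.isLocalCocycle_geodesicCocycle he (by positivity)
      (by simpa only [mul_div_cancel₀ L three_ne_zero] using hL.2)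
  calc increment e f 0 L = chainProd (hX.geodesicCocycle e) (inscribedHexagon f L) :=
        (hX.chainProd_inscribedHexagon he hL.2 hLpos hf).symm
    _ = 1 := (hcocycle.chainProd_eq_of_epsHomotopic hnull).trans (chainProd_singleton _)

theorem IsGeodesicSpace.exists_oneSystole_eq [CompactSpace X] [Nonempty X]
    (hX : IsGeodesicSpace X) (hs : SemilocallySimplyConnected X)
    (hn : ¬ SimplyConnectedSpace X) :
    ∃ L, 0 < L ∧ oneSystole X = ENNReal.ofReal L ∧ L / 3 ∈ homotopyCriticalSpectrum X := by
  have := hX.pathConnectedSpace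
  obtain ⟨x₀⟩ := ‹Nonempty X›
  obtain ⟨R, hR, hball⟩ := hs.exists_ballPathsHomotopic
  have he := hball.isLocalCocycle_pathCocycle hR hX x₀
  obtain ⟨L, hL⟩ := he.exists_isLeast_nontrivialLoopLengths
    (hball.nontrivialLoopLengths_pathCocycle_nonempty hR hX x₀ hn)
  have hLgeodesic : IsLeast (nonNullGeodesicLengths X) L :=
    ⟨hX.mem_nonNullGeodesicLengths he hL,
      fun ℓ hℓ => hL.2 (hball.nonNullGeodesicLengths_subset hR hX x₀ hℓ)⟩
  exact ⟨L, pos_of_mem_nontrivialLoopLengths hL.1, oneSystole_eq_ofReal hLgeodesic,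
    hX.div_three_mem_homotopyCriticalSpectrum he hL⟩

end Hexagon

end DiscreteHomotopy

end

theorem corollary3 {X : Type*} [MetricSpace X] [CompactSpace X] [Nonempty X]
    (hX : DiscreteHomotopy.IsGeodesicSpace X) :
    (∀ ε ∈ DiscreteHomotopy.homotopyCriticalSpectrum X,
      DiscreteHomotopy.oneSystole X / 3 ≤ ENNReal.ofReal ε) ∧
    (DiscreteHomotopy.SemilocallySimplyConnected X → ¬ SimplyConnectedSpace X →
      0 < DiscreteHomotopy.oneSystole X ∧ DiscreteHomotopy.oneSystole X ≠ ⊤ ∧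
      IsLeast (DiscreteHomotopy.homotopyCriticalSpectrum X)
        ((DiscreteHomotopy.oneSystole X).toReal / 3)) := by
  refine ⟨fun ε hε => DiscreteHomotopy.oneSystole_div_three_le hX hε, fun hs hn => ?_⟩
  obtain ⟨L, hL, hsys, hmem⟩ := hX.exists_oneSystole_eq hs hn
  rw [hsys, ENNReal.toReal_ofReal hL.le]
  refine ⟨ENNReal.ofReal_pos.2 hL, ENNReal.ofReal_ne_top, hmem, fun ε hε => ?_⟩
  have hle := DiscreteHomotopy.oneSystole_div_three_le hX hε
  rw [hsys, ← ENNReal.ofReal_ofNat, ← ENNReal.ofReal_div_of_pos three_pos] at hle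
  exact (ENNReal.ofReal_le_ofReal_iff hε.1.le).1 hle
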